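/- A binary tree is either the empty tree $\emptyset$ or a root node carrying an ordered pair $(L,R)$ of binary trees, its left and right subtrees; write $T=\bullet(L,R)$. A right rotation of a tree replaces one subtree of the form $y(x(A,B),C)$ by $x(A,y(B,C))$, where $A,B,C$ are binary trees, possibly empty. In the Tamari order, $S\le T$ if $T$ can be obtained from $S$ by a finite (possibly empty) sequence of right rotations. The left branch (resp. right branch) of a nonempty tree consists of the root, its left (resp. right) child, the left (resp. right) child of that node, and so on; the branches of $\emptyset$ have no nodes. For polynomials $f,g$ in $x$ with coefficients depending on $y$, put $$B(f,g)=x\,y\,f\cdot\frac{x\,g-g|_{x=1}}{x-1},$$ which is again a polynomial. The Tamari polynomial $\mathcal B_T(x)\in\mathbb Z[x]$ of a binary tree is defined recursively by $\mathcal B_\emptyset=1$ and $\mathcal B_T=B_{y=1}(\mathcal B_L,\mathcal B_R)$ for $T=\bullet(L,R)$. The polynomial $\tilde{\mathcal B}_T(x)\in\mathbb Z[x]$ is defined by exchanging the roles of the two subtrees: $\tilde{\mathcal B}_\emptyset=1$ and $\tilde{\mathcal B}_T=B_{y=1}(\tilde{\mathcal B}_R,\tilde{\mathcal B}_L)$ for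 $T=\bullet(L,R)$. Theorem. Let $T$ be a binary tree. 1. The set of trees $T'\le T$ is finite, and for every integer $k\ge 0$ the coefficient of $x^k$ in $\mathcal B_T(x)$ is the number of trees $T'\le T$ having exactly $k$ nodes on their left branch. In particular $\mathcal B_T(1)$ is the number of trees $T'\le T$. 2. The set of trees $T'\ge T$ is finite, and for every integer $k\ge 0$ the coefficient of $x^k$ in $\tilde{\mathcal B}_T(x)$ is the number of trees $T'\ge T$ having exactly $k$ nodes on their right branch. In particular $\tilde{\mathcal B}_T(1)$ is the number of trees $T'\ge T$. -/

import Mathlib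

namespace Tamari

open Polynomial

/-- A (planar) binary tree: either empty (`BinaryTree.nil`) or a root carrying a left and a right
binary subtree. -/
abbrev BinTree : Type := BinaryTree Unit

/-- The tree with root `•`, left subtree `L` and right subtree `R`. -/
abbrev graft (L R : BinTree) : BinTree := BinaryTree.node () L R

/-- `RightRotation S T`: the tree `T` is obtained from `S` by one right rotation at some node, that
is, by replacing one subtree `y(x(A, B), C)` of `S` by `x(A, y(B, C))`. -/
inductive RightRotation : BinTree → BinTree → Prop
  | root (A B C : BinTree) : RightRotation (graft (graft A B) C) (graft A (graft B C))
  | left {L L' : BinTree} (R : BinTree) (h : RightRotation L L') :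
      RightRotation (graft L R) (graft L' R)
  | right (L : BinTree) {R R' : BinTree} (h : RightRotation R R') :
      RightRotation (graft L R) (graft L R')

/-- The Tamari order: `TamariLE S T` if `T` can be reached from `S` by a (possibly empty) sequence
of right rotations. -/
def TamariLE (S T : BinTree) : Prop := Relation.ReflTransGen RightRotation S T

/-- The number of nodes on the left branch: the root, its left child, the left child of that, etc. -/
def leftBranch : BinTree → ℕ
  | .nil => 0
  | .node _ L _ => leftBranch L + 1

/-- The number of nodes on the right branch. -/
def rightBranch : BinTree → ℕ
  | .nil => 0
  | .node _ _ R => rightBranch R + 1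

/-- The bilinear operator `B(f, g) = x y f (x g - g(1)) / (x - 1)` on polynomials in `x`, with `y`
any element of the coefficient ring. The division by the monic polynomial `x - 1` is exact,
see `sub_one_mul_B`. -/
noncomputable def B {K : Type*} [CommRing K] (y : K) (f g : K[X]) : K[X] :=
  X * C y * f * ((X * g - C (g.eval 1)) /ₘ (X - C 1))

theorem sub_one_mul_B {K : Type*} [CommRing K] (y : K) (f g : K[X]) :
    (X - C 1) * B y f g = X * C y * f * (X * g - C (g.eval 1)) := by
  have h : (X - C 1) * ((X * g - C (g.eval 1)) /ₘ (X - C 1)) = X * g - C (g.eval 1) :=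
    mul_divByMonic_eq_iff_isRoot.2 (by simp [IsRoot.def])
  rw [B, mul_left_comm, h]

/-- The Tamari polynomial `B_T(x)` of a binary tree. -/
noncomputable def tamariPoly : BinTree → ℤ[X]
  | .nil => 1
  | .node _ L R => B 1 (tamariPoly L) (tamariPoly R)

/-- The polynomial obtained by exchanging the roles of the left and the right subtrees in the
definition of the Tamari polynomial. -/
noncomputable def tamariPolyRev : BinTree → ℤ[X]
  | .nil => 1
  | .node _ L R => B 1 (tamariPolyRev R) (tamariPolyRev L)

end Tamari

/-!
In a tree `S ≤ •(L, R)`, the node of `S` that corresponds to the root of `•(L, R)` lies on the left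
branch of `S`, and pulling it back up to the root turns `S` into `•(L', R')` with `L' ≤ L` and
`R' ≤ R`. Conversely, `S` is recovered from `L'`, `R'` and the depth `k ≤ leftBranch R'` of that
node, and its left branch has `leftBranch L' + 1 + k` nodes. On the generating functions of the
left branches this is the recursion defining `tamariPoly`, since
`B(x ^ m, x ^ n) = y (x ^ (m + 1) + ⋯ + x ^ (m + 1 + n))`. The mirror image of trees reverses the
order and exchanges the branches, which reduces the second half to the first.
-/

namespace Tamari

open Polynomial

section Polynomials

variable {K : Type*} [CommRing K] {α β : Type*}

theorem eq_B_of_sub_one_mul_eq {y : K} {f g h : K[X]}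
    (H : (X - C 1) * h = X * C y * f * (X * g - C (g.eval 1))) : h = B y f g :=
  (monic_X_sub_C 1).isRegular.left (H.trans (sub_one_mul_B y f g).symm)

theorem B_sum_left (y : K) (s : Finset α) (f : α → K[X]) (g : K[X]) :
    B y (∑ a ∈ s, f a) g = ∑ a ∈ s, B y (f a) g := by
  simp only [B, Finset.mul_sum, Finset.sum_mul]

theorem B_sum_right (y : K) (f : K[X]) (t : Finset β) (g : β → K[X]) :
    B y f (∑ b ∈ t, g b) = ∑ b ∈ t, B y f (g b) := by
  refine (eq_B_of_sub_one_mul_eq ?_).symm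
  simp only [Finset.mul_sum, sub_one_mul_B, eval_finsetSum, map_sum, ← Finset.sum_sub_distrib]

theorem B_X_pow_X_pow (y : K) (m n : ℕ) :
    B y (X ^ m) (X ^ n) = C y * ∑ k ∈ Finset.range (n + 1), X ^ (m + 1 + k) := by
  refine (eq_B_of_sub_one_mul_eq ?_).symm
  calc (X - C 1) * (C y * ∑ k ∈ Finset.range (n + 1), X ^ (m + 1 + k))
      = C y * X ^ (m + 1) * ((X - 1) * ∑ k ∈ Finset.range (n + 1), X ^ k) := by
        simp only [pow_add _ (m + 1), ← Finset.mul_sum, C_1]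
        ring
    _ = C y * X ^ (m + 1) * (X ^ (n + 1) - 1) := by rw [mul_geom_sum]
    _ = X * C y * X ^ m * (X * X ^ n - C ((X ^ n : K[X]).eval 1)) := by
        rw [eval_X_pow, one_pow, C_1]
        ring

end Polynomials

section GeneratingFunctions

variable {R : Type*} [Semiring R] {α : Type*}

theorem coeff_sum_X_pow (s : Finset α) (f : α → ℕ) (k : ℕ) :
    (∑ a ∈ s, (X : R[X]) ^ f a).coeff k = ({a | a ∈ s ∧ f a = k}.ncard : R) := by
  have h : {a | a ∈ s ∧ f a = k} = (s.filter fun a => k = f a : Finset α) := by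
    ext a
    simp [eq_comm]
  rw [h, Set.ncard_coe_finset]
  simp [coeff_X_pow]

theorem eval_one_sum_X_pow (s : Finset α) (f : α → ℕ) :
    (∑ a ∈ s, (X : R[X]) ^ f a).eval 1 = ({a | a ∈ s}.ncard : R) := by
  rw [Finset.setOfPred_mem, Set.ncard_coe_finset]
  simp [eval_finsetSum, ← monomial_one_right_eq_X_pow]

end GeneratingFunctions

section TamariOrder

theorem TamariLE.refl (T : BinTree) : TamariLE T T := Relation.ReflTransGen.refl

theorem TamariLE.trans {S T U : BinTree} (hST : TamariLE S T) (hTU : TamariLE T U) :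
    TamariLE S U :=
  Relation.ReflTransGen.trans hST hTU

theorem RightRotation.tamariLE {S T : BinTree} (h : RightRotation S T) : TamariLE S T :=
  Relation.ReflTransGen.single h

theorem TamariLE.graft {L L' R R' : BinTree} (hL : TamariLE L L') (hR : TamariLE R R') :
    TamariLE (graft L R) (graft L' R') :=
  TamariLE.trans
    (Relation.ReflTransGen.lift (Tamari.graft · R) (fun _ _ h => .left R h) _ _ hL)
    (Relation.ReflTransGen.lift (Tamari.graft L' ·) (fun _ _ h => .right L' h) _ _ hR)

theorem tamariLE_nil_iff {T : BinTree} : TamariLE T .nil ↔ T = .nil := by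
  refine ⟨fun h => ?_, fun h => h ▸ .refl _⟩
  cases h with
  | refl => rfl
  | tail _ h => cases h

theorem RightRotation.numNodes_eq {S T : BinTree} (h : RightRotation S T) :
    S.numNodes = T.numNodes := by
  induction h <;> simp only [BinaryTree.numNodes] <;> omega

theorem TamariLE.numNodes_eq {S T : BinTree} (h : TamariLE S T) : S.numNodes = T.numNodes := by
  induction h with
  | refl => rfl
  | tail _ h ih => exact ih.trans h.numNodes_eq

end TamariOrder

section Insertion

/-- `insertAt L k R` replaces the subtree `S` of `R` at depth `k` on its left branch by
`graft L S`. The depth is meant to be at most `leftBranch R`; at this depth `S` is empty, and larger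
depths give the same tree. -/
def insertAt (L : BinTree) : ℕ → BinTree → BinTree
  | 0, R => graft L R
  | _ + 1, .nil => graft L .nil
  | k + 1, .node _ A C => graft (insertAt L k A) C

theorem leftBranch_insertAt (L : BinTree) :
    ∀ {k : ℕ} {R : BinTree}, k ≤ leftBranch R →
      leftBranch (insertAt L k R) = leftBranch L + 1 + k
  | 0, _, _ => rfl
  | _ + 1, .node _ _ _, hk =>
    congrArg (· + 1) (leftBranch_insertAt L (Nat.le_of_succ_le_succ hk))

theorem numNodes_insertAt (L : BinTree) :
    ∀ (k : ℕ) (R : BinTree), (insertAt L k R).numNodes = L.numNodes + R.numNodes + 1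
  | 0, _ => rfl
  | _ + 1, .nil => rfl
  | k + 1, .node _ A C => by
    simp only [insertAt, BinaryTree.numNodes, numNodes_insertAt L k A]
    omega

theorem insertAt_tamariLE_graft (L : BinTree) :
    ∀ (k : ℕ) (R : BinTree), TamariLE (insertAt L k R) (graft L R)
  | 0, _ => .refl _
  | _ + 1, .nil => .refl _
  | k + 1, .node _ A C =>
    ((insertAt_tamariLE_graft L k A).graft (.refl C)).trans (RightRotation.root L A C).tamariLE

theorem ne_insertAt_of_numNodes_eq {L L' : BinTree} (hL : L.numNodes = L'.numNodes) (k : ℕ)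
    (R : BinTree) : L ≠ insertAt L' k R := by
  rintro rfl
  have := numNodes_insertAt L' k R
  omega

theorem eq_of_insertAt_eq {L L' : BinTree} (hL : L.numNodes = L'.numNodes) :
    ∀ {k k' : ℕ} {R R' : BinTree}, k ≤ leftBranch R → k' ≤ leftBranch R' →
      insertAt L k R = insertAt L' k' R' → L = L' ∧ k = k' ∧ R = R'
  | 0, 0, _, _, _, _, h => by simpa [insertAt] using h
  | 0, k' + 1, _, .node _ A' _, _, _, h =>
    absurd (BinaryTree.node.inj h).2.1 (ne_insertAt_of_numNodes_eq hL k' A')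
  | k + 1, 0, .node _ A _, _, _, _, h =>
    absurd (BinaryTree.node.inj h).2.1.symm (ne_insertAt_of_numNodes_eq hL.symm k A)
  | k + 1, k' + 1, .node _ A C, .node _ A' C', hk, hk', h => by
    obtain ⟨-, hA, rfl⟩ := BinaryTree.node.inj h
    obtain ⟨rfl, rfl, rfl⟩ :=
      eq_of_insertAt_eq hL (Nat.le_of_succ_le_succ hk) (Nat.le_of_succ_le_succ hk') hA
    exact ⟨rfl, rfl, rfl⟩

theorem exists_insertAt_of_rightRotation {L : BinTree} :
    ∀ {k : ℕ} {R S : BinTree}, k ≤ leftBranch R → RightRotation S (insertAt L k R) →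
      ∃ L' R', TamariLE L' L ∧ TamariLE R' R ∧ ∃ k' ≤ leftBranch R', insertAt L' k' R' = S
  | 0, _, _, _, .root _ B C =>
    ⟨L, graft B C, .refl _, .refl _, 1, Nat.succ_le_succ (Nat.zero_le _), rfl⟩
  | 0, R, _, _, .left _ h => ⟨_, R, h.tamariLE, .refl R, 0, Nat.zero_le _, rfl⟩
  | 0, _, _, _, .right _ h => ⟨L, _, .refl L, h.tamariLE, 0, Nat.zero_le _, rfl⟩
  | k + 1, .node _ A (.node _ B C), _, hk, .root _ _ _ =>
    ⟨L, _, .refl L, (RightRotation.root A B C).tamariLE, k + 2, Nat.succ_le_succ hk, rfl⟩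
  | k + 1, .node _ A C, _, hk, .left _ h =>
    have ⟨L', _, hL, hA, k', hk', hS⟩ :=
      exists_insertAt_of_rightRotation (Nat.le_of_succ_le_succ hk) h
    ⟨L', _, hL, hA.graft (.refl C), k' + 1, Nat.succ_le_succ hk', congrArg (graft · C) hS⟩
  | k + 1, .node _ A _, _, hk, .right _ h =>
    ⟨L, _, .refl L, (TamariLE.refl A).graft h.tamariLE, k + 1, hk, rfl⟩

theorem tamariLE_graft_iff {L R S : BinTree} :
    TamariLE S (graft L R) ↔
      ∃ L' R', TamariLE L' L ∧ TamariLE R' R ∧ ∃ k ≤ leftBranch R', insertAt L' k R' = S := by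
  constructor
  · intro h
    induction h using Relation.ReflTransGen.head_induction_on with
    | refl => exact ⟨L, R, .refl _, .refl _, 0, Nat.zero_le _, rfl⟩
    | head hrot _ ih =>
      obtain ⟨L₁, R₁, hL₁, hR₁, k, hk, rfl⟩ := ih
      obtain ⟨L₂, R₂, hL₂, hR₂, hS⟩ := exists_insertAt_of_rightRotation hk hrot
      exact ⟨L₂, R₂, hL₂.trans hL₁, hR₂.trans hR₁, hS⟩
  · rintro ⟨L', R', hL, hR, k, -, rfl⟩
    exact (insertAt_tamariLE_graft L' k R').trans (hL.graft hR)

end Insertion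

section LowerTrees

/-- The finite set of trees below a given tree in the Tamari order. -/
def lowerTrees : BinTree → Finset BinTree
  | .nil => {.nil}
  | .node _ L R =>
    ((lowerTrees L ×ˢ lowerTrees R).sigma fun p => Finset.range (leftBranch p.2 + 1)).image
      fun q => insertAt q.1.1 q.2 q.1.2

theorem mem_lowerTrees {S T : BinTree} : S ∈ lowerTrees T ↔ TamariLE S T := by
  induction T generalizing S with
  | nil => rw [lowerTrees, Finset.mem_singleton, tamariLE_nil_iff]
  | node _ L R ihL ihR =>
    rw [tamariLE_graft_iff]
    simp [lowerTrees, ihL, ihR, and_assoc]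

theorem sum_lowerTrees_graft {M : Type*} [AddCommMonoid M] (F : BinTree → M) (L R : BinTree) :
    ∑ S ∈ lowerTrees (graft L R), F S =
      ∑ L' ∈ lowerTrees L, ∑ R' ∈ lowerTrees R,
        ∑ k ∈ Finset.range (leftBranch R' + 1), F (insertAt L' k R') := by
  rw [lowerTrees, Finset.sum_image, Finset.sum_sigma, Finset.sum_product]
  rintro ⟨⟨L₁, R₁⟩, k₁⟩ h₁ ⟨⟨L₂, R₂⟩, k₂⟩ h₂ heq
  simp only [Finset.coe_sigma, Set.mem_sigma_iff, Finset.mem_coe, Finset.mem_product,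
    mem_lowerTrees, Finset.mem_range, Nat.lt_succ_iff] at h₁ h₂
  obtain ⟨rfl, rfl, rfl⟩ :=
    eq_of_insertAt_eq (h₁.1.1.numNodes_eq.trans h₂.1.1.numNodes_eq.symm) h₁.2 h₂.2 heq
  rfl

theorem tamariPoly_eq_sum (T : BinTree) :
    tamariPoly T = ∑ S ∈ lowerTrees T, X ^ leftBranch S := by
  induction T with
  | nil => simp [tamariPoly, lowerTrees, leftBranch]
  | node _ L R ihL ihR =>
    rw [tamariPoly, ihL, ihR, sum_lowerTrees_graft, B_sum_left]
    refine Finset.sum_congr rfl fun L' _ => ?_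
    rw [B_sum_right]
    refine Finset.sum_congr rfl fun R' _ => ?_
    rw [B_X_pow_X_pow, C_1, one_mul]
    refine Finset.sum_congr rfl fun k hk => ?_
    rw [leftBranch_insertAt L' (Nat.le_of_lt_succ (Finset.mem_range.1 hk))]

end LowerTrees

section Mirror

/-- The mirror image of a binary tree, which exchanges left and right. -/
def mirror : BinTree → BinTree
  | .nil => .nil
  | .node _ L R => graft (mirror R) (mirror L)

theorem mirror_involutive : Function.Involutive mirror := by
  intro T
  induction T with
  | nil => rfl
  | node _ L R ihL ihR => rw [mirror, mirror, ihL, ihR]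

theorem RightRotation.mirror {S T : BinTree} (h : RightRotation S T) :
    RightRotation (mirror T) (mirror S) := by
  induction h with
  | root A B C => exact .root _ _ _
  | left R _ ih => exact .right _ ih
  | right L _ ih => exact .left _ ih

theorem TamariLE.mirror {S T : BinTree} (h : TamariLE S T) :
    TamariLE (mirror T) (mirror S) := by
  induction h with
  | refl => exact .refl _
  | tail _ h ih => exact h.mirror.tamariLE.trans ih

theorem tamariLE_mirror_iff {S T : BinTree} :
    TamariLE (mirror S) (mirror T) ↔ TamariLE T S :=
  ⟨fun h => by simpa only [mirror_involutive _] using h.mirror, .mirror⟩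

theorem rightBranch_mirror (T : BinTree) : rightBranch (mirror T) = leftBranch T := by
  induction T with
  | nil => rfl
  | node _ L R ihL _ => rw [mirror, rightBranch, leftBranch, ihL]

theorem tamariPoly_mirror (T : BinTree) : tamariPoly (mirror T) = tamariPolyRev T := by
  induction T with
  | nil => rfl
  | node _ L R ihL ihR => rw [mirror, tamariPoly, tamariPolyRev, ihL, ihR]

end Mirror

section UpperTrees

/-- The finite set of trees above a given tree in the Tamari order, obtained as the mirror images of
the trees below its mirror image. -/
def upperTrees (T : BinTree) : Finset BinTree := (lowerTrees (mirror T)).image mirror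

theorem mem_upperTrees {S T : BinTree} : S ∈ upperTrees T ↔ TamariLE T S := by
  rw [← tamariLE_mirror_iff, ← mem_lowerTrees, upperTrees, Finset.mem_image]
  refine ⟨?_, fun h => ⟨mirror S, h, mirror_involutive S⟩⟩
  rintro ⟨U, hU, rfl⟩
  rwa [mirror_involutive]

theorem tamariPolyRev_eq_sum (T : BinTree) :
    tamariPolyRev T = ∑ S ∈ upperTrees T, X ^ rightBranch S := by
  rw [← tamariPoly_mirror, tamariPoly_eq_sum, upperTrees,
    Finset.sum_image mirror_involutive.injective.injOn]
  simp only [rightBranch_mirror]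

end UpperTrees

end Tamari

/-- For every binary tree `T`: only finitely many trees are below (resp. above) `T` in the Tamari
order; the coefficient of `x ^ k` in the Tamari polynomial of `T` is the number of trees below `T`
with `k` nodes on their left branch, and its value at `1` is the number of all trees below `T`;
symmetrically for the reversed polynomial, the trees above `T` and their right branches. -/
theorem mainTheorem2 (T : Tamari.BinTree) :
    ({T' | Tamari.TamariLE T' T}.Finite ∧
      (∀ k : ℕ, (Tamari.tamariPoly T).coeff k =
        ({T' | Tamari.TamariLE T' T ∧ Tamari.leftBranch T' = k}.ncard : ℤ)) ∧
      (Tamari.tamariPoly T).eval 1 = ({T' | Tamari.TamariLE T' T}.ncard : ℤ)) ∧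
    ({T' | Tamari.TamariLE T T'}.Finite ∧
      (∀ k : ℕ, (Tamari.tamariPolyRev T).coeff k =
        ({T' | Tamari.TamariLE T T' ∧ Tamari.rightBranch T' = k}.ncard : ℤ)) ∧
      (Tamari.tamariPolyRev T).eval 1 = ({T' | Tamari.TamariLE T T'}.ncard : ℤ)) := by
  constructor
  · simp only [← Tamari.mem_lowerTrees, Tamari.tamariPoly_eq_sum, Tamari.coeff_sum_X_pow,
      Tamari.eval_one_sum_X_pow, implies_true, and_true]
    exact (Tamari.lowerTrees T).finite_toSet
  · simp only [← Tamari.mem_upperTrees, Tamari.tamariPolyRev_eq_sum, Tamari.coeff_sum_X_pow,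
      Tamari.eval_one_sum_X_pow, implies_true, and_true]
    exact (Tamari.upperTrees T).finite_toSet
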